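/- Let $k$ be an algebraically closed field and let $A$ be a basic connected finite dimensional $k$-algebra whose ordinary quiver $Q$ has no oriented cycles. Fix a complete set $\{e_x\}_{x\in Q_0}$ of primitive orthogonal idempotents of $A$, a vertex $x_0\in Q_0$ and a maximal tree $T$ of $Q$; let $\gamma_x$ be the walk of minimal length in $T$ from $x_0$ to $x$. Paths and walks are written from the right to the left. Conventions. - $E=\bigoplus_x k e_x$ and $\mathfrak r$ is the radical of $A$. $Der_0(A)$ is the space of $k$-linear derivations $d\colon A\to A$ with $d(e_x)=0$ for all $x$, $Int_0(A)=\{\,a\mapsto ca-ac \mid c\in E\,\}$, and $HH^1(A)=Der_0(A)/Int_0(A)$. - A presentation is a surjective $k$-algebra homomorphism $\nu\colon kQ\to A$ with $\nu(e_x)=e_x$ for all $x$ whose kernel is admissible: $(kQ^+)^N\subseteq \mathrm{Ker}\,\nu\subseteq (kQ^+)^2$ for some $N\ge 2$, where $kQ^+$ is the ideal generated by the arrows. - A minimal relation of $I=\mathrm{Ker}\,\nu$ is a nonzero element $\sum_{i=1}^s t_iu_i\in I$, with $t_i\in k^*$ and pairwise distinct paths $u_i$, such that $\sum_{i\in S}t_iu_i\notin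 I$ for every nonempty proper $S\subset\{1,\dots,s\}$. The homotopy relation $\sim_I$ on walks of $Q$ is the equivalence relation compatible with concatenation that is generated by $\alpha\alpha^{-1}\sim_I e_y$ and $\alpha^{-1}\alpha\sim_I e_x$ for every arrow $\alpha\colon x\to y$, and by $u\sim_I v$ whenever $u,v$ are paths occurring in a same minimal relation of $I$. The group $\pi_1(Q,I)$ consists of the classes $[\gamma]$ of walks $\gamma$ from $x_0$ to $x_0$, with concatenation. - $\theta_\nu\colon \mathrm{Hom}(\pi_1(Q,\mathrm{Ker}\,\nu),k^+)\to HH^1(A)$ is the group homomorphism that sends $g$ to the class of the derivation $\widetilde g\in Der_0(A)$ with $\widetilde g(\nu(u))=g([\gamma_y^{-1}u\gamma_x])\,\nu(u)$ for every path $u$ from $x$ to $y$. - A basis of $A$ means a $k$-basis $\mathcal B$ of $A$ with $\mathcal B\subseteq\bigcup_{x,y} e_yAe_x$, $\{e_x\}_{x\in Q_0}\subseteq\mathcal B$ and $\mathcal B\setminus\{e_x\}_{x\in Q_0}\subseteq\mathfrak r$. An element $f\in HH^1(A)$ is diagonal with respect to $\mathcal B$ if some (equivalently, every) $d\in Der_0(A)$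 representing $f$ has every element of $\mathcal B$ as an eigenvector (that is, $d(b)\in kb$ for all $b\in\mathcal B$). A presentation $\nu$ is adapted to $\mathcal B$ if $\nu(\alpha)\in\mathcal B$ for every arrow $\alpha$ of $Q$. Lemma. Let $f\in HH^1(A)$ be diagonal with respect to a basis $\mathcal B$ of $A$ and let $\nu\colon kQ\to A$ be a presentation adapted to $\mathcal B$. Then $f\in\mathrm{Im}\,\theta_\nu$. More precisely, let $d\in Der_0(A)$ represent $f$ and let $t_\alpha\in k$ be the scalars with $d(\nu(\alpha))=t_\alpha\,\nu(\alpha)$ for the arrows $\alpha$ of $Q$. Then there is a well defined group homomorphism $g\colon\pi_1(Q,\mathrm{Ker}\,\nu)\to k^+$ such that $g([\alpha_n^{\varepsilon_n}\cdots\alpha_1^{\varepsilon_1}])=\sum_{i=1}^n\varepsilon_i t_{\alpha_i}$ for every walk $\alpha_n^{\varepsilon_n}\cdots\alpha_1^{\varepsilon_1}$ from $x_0$ to $x_0$ (with $\alpha_i\in Q_1$ and $\varepsilon_i\in\{\pm1\}$), and $\theta_\nu(g)=f$. -/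

import Mathlib

universe u v w z

noncomputable section

namespace QuiverHH

open Quiver

/-! ### Paths and the path algebra -/

/-- An oriented path of the quiver `V` (trivial paths included), with its source and target. -/
structure QPath (V : Type u) [Quiver.{v} V] where
  {src tgt : V}
  path : Quiver.Path src tgt

/-- The path algebra `kQ`: the vector space with basis the set of all oriented paths. -/
def PathAlgebra (k : Type w) (V : Type u) [Field k] [Quiver.{v} V] : Type (max u v w) :=
  QPath V →₀ k

namespace PathAlgebra

variable {k : Type w} {V : Type u} [Field k] [Quiver.{v} V]

instance : AddCommGroup (PathAlgebra k V) := inferInstanceAs (AddCommGroup (QPath V →₀ k))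

instance : Module k (PathAlgebra k V) := inferInstanceAs (Module k (QPath V →₀ k))

/-- The basis of the path algebra given by the paths. -/
def basis (k : Type w) (V : Type u) [Field k] [Quiver.{v} V] :
    Module.Basis (QPath V) k (PathAlgebra k V) :=
  ⟨LinearEquiv.refl k (QPath V →₀ k)⟩

/-- The element of `kQ` given by a path. -/
def ofPath (k : Type w) {V : Type u} [Field k] [Quiver.{v} V] (p : QPath V) : PathAlgebra k V :=
  basis k V p

/-- The element of `kQ` given by the trivial path `e_x`. -/
def vertex (k : Type w) {V : Type u} [Field k] [Quiver.{v} V] (x : V) : PathAlgebra k V :=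
  ofPath k ⟨(Quiver.Path.nil : Quiver.Path x x)⟩

/-- The element of `kQ` given by an arrow. -/
def arrow (k : Type w) {V : Type u} [Field k] [Quiver.{v} V] {x y : V} (a : x ⟶ y) :
    PathAlgebra k V :=
  ofPath k ⟨a.toPath⟩

open Classical in
/-- The product `v u` of two paths, read from the right to the left: first `u`, then `v`; it is
zero if the source of `v` is not the target of `u`. -/
def mulPath (k : Type w) {V : Type u} [Field k] [Quiver.{v} V] (v u : QPath V) :
    PathAlgebra k V :=
  if h : u.tgt = v.src then ofPath k ⟨u.path.comp (v.path.cast h.symm rfl)⟩ else 0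

/-- The bilinear extension of the product of paths. -/
def mulHom (k : Type w) (V : Type u) [Field k] [Quiver.{v} V] :
    PathAlgebra k V →ₗ[k] PathAlgebra k V →ₗ[k] PathAlgebra k V :=
  (basis k V).constr k fun v => (basis k V).constr k fun u => mulPath k v u

instance : Mul (PathAlgebra k V) := ⟨fun a b => mulHom k V a b⟩

theorem mul_def (a b : PathAlgebra k V) : a * b = mulHom k V a b := rfl

theorem ofPath_mul (v u : QPath V) : ofPath k v * ofPath k u = mulPath k v u := by
  simp [mul_def, mulHom, ofPath]

theorem mulPath_comp {x y z : V} (p : Quiver.Path x y) (q : Quiver.Path y z) :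
    mulPath k ⟨q⟩ ⟨p⟩ = ofPath k ⟨p.comp q⟩ := by
  simp [mulPath]

theorem mulPath_ne {v u : QPath V} (h : u.tgt ≠ v.src) : mulPath k v u = 0 := by
  simp [mulPath, h]

theorem ofPath_mul_assoc (a b c : QPath V) :
    ofPath k a * ofPath k b * ofPath k c = ofPath k a * (ofPath k b * ofPath k c) := by
  obtain @⟨x, y, a⟩ := a
  obtain @⟨x', y', b⟩ := b
  obtain @⟨x'', y'', c⟩ := c
  simp only [ofPath_mul]
  by_cases h1 : y' = x
  · subst h1
    by_cases h2 : y'' = x'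
    · subst h2
      simp only [mulPath_comp, ofPath_mul, Quiver.Path.comp_assoc]
    · rw [mulPath_comp, ofPath_mul, mulPath_ne h2, mulPath_ne h2]
      simp [mul_def]
  · rw [mulPath_ne h1]
    by_cases h2 : y'' = x'
    · subst h2
      rw [mulPath_comp, ofPath_mul, mulPath_ne h1]
      simp [mul_def]
    · rw [mulPath_ne h2]
      simp [mul_def]

theorem induction_path {P : PathAlgebra k V → Prop} (a : PathAlgebra k V)
    (h0 : P 0) (hp : ∀ p, P (ofPath k p)) (ha : ∀ a b, P a → P b → P (a + b))
    (hs : ∀ (c : k) a, P a → P (c • a)) : P a := by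
  have h : a ∈ Submodule.span k (Set.range (basis k V)) := by
    rw [(basis k V).span_eq]; trivial
  induction h using Submodule.span_induction with
  | mem x hx => obtain ⟨p, rfl⟩ := hx; exact hp p
  | zero => exact h0
  | add x y _ _ hx hy => exact ha x y hx hy
  | smul c x _ hx => exact hs c x hx

instance : NonUnitalRing (PathAlgebra k V) where
  left_distrib a b c := by simp [mul_def]
  right_distrib a b c := by simp [mul_def]
  zero_mul a := by simp [mul_def]
  mul_zero a := by simp [mul_def]
  mul_assoc a b c := by
    induction a using induction_path with
    | h0 => simp [mul_def]
    | ha a a' h h' => simp only [mul_def, map_add, LinearMap.add_apply] at *; rw [h, h']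
    | hs t a h => simp only [mul_def, map_smul, LinearMap.smul_apply] at *; rw [h]
    | hp p =>
    induction b using induction_path with
    | h0 => simp [mul_def]
    | ha a a' h h' => simp only [mul_def, map_add, LinearMap.add_apply] at *; rw [h, h']
    | hs t a h => simp only [mul_def, map_smul, LinearMap.smul_apply] at *; rw [h]
    | hp q =>
    induction c using induction_path with
    | h0 => simp [mul_def]
    | ha a a' h h' => simp only [mul_def, map_add] at *; rw [h, h']
    | hs t a h => simp only [mul_def, map_smul] at *; rw [h]
    | hp r => exact ofPath_mul_assoc p q r

theorem vertex_mul_ofPath (p : QPath V) : vertex k p.tgt * ofPath k p = ofPath k p := by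
  obtain @⟨x, y, p⟩ := p
  rw [vertex, ofPath_mul, mulPath_comp, Quiver.Path.comp_nil]

theorem vertex_mul_ofPath_ne {x : V} (p : QPath V) (h : p.tgt ≠ x) :
    vertex k x * ofPath k p = 0 := by
  rw [vertex, ofPath_mul, mulPath_ne h]

theorem ofPath_mul_vertex (p : QPath V) : ofPath k p * vertex k p.src = ofPath k p := by
  obtain @⟨x, y, p⟩ := p
  rw [vertex, ofPath_mul, mulPath_comp, Quiver.Path.nil_comp]

theorem ofPath_mul_vertex_ne {x : V} (p : QPath V) (h : p.src ≠ x) :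
    ofPath k p * vertex k x = 0 := by
  rw [vertex, ofPath_mul, mulPath_ne (Ne.symm h)]

variable [Fintype V]

instance : One (PathAlgebra k V) := ⟨∑ x : V, vertex k x⟩

theorem one_def : (1 : PathAlgebra k V) = ∑ x : V, vertex k x := rfl

instance : Ring (PathAlgebra k V) where
  __ := (inferInstance : NonUnitalRing (PathAlgebra k V))
  one_mul a := by
    induction a using induction_path with
    | h0 => simp
    | ha a a' h h' => rw [mul_add, h, h']
    | hs t a h => simp only [mul_def, map_smul] at *; rw [h]
    | hp p =>
      rw [one_def, Finset.sum_mul, Finset.sum_eq_single p.tgt, vertex_mul_ofPath]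
      · intro x _ hx; exact vertex_mul_ofPath_ne p hx.symm
      · simp
  mul_one a := by
    induction a using induction_path with
    | h0 => simp
    | ha a a' h h' => rw [add_mul, h, h']
    | hs t a h => simp only [mul_def, map_smul, LinearMap.smul_apply] at *; rw [h]
    | hp p =>
      rw [one_def, Finset.mul_sum, Finset.sum_eq_single p.src, ofPath_mul_vertex]
      · intro x _ hx; exact ofPath_mul_vertex_ne p hx.symm
      · simp

instance : Algebra k (PathAlgebra k V) :=
  Algebra.ofModule (fun r a b => by simp [mul_def]) (fun r a b => by simp [mul_def])

/-- The two-sided ideal `kQ⁺` of `kQ` generated by the arrows, as a subspace; its powers are the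
powers of ideals. -/
def arrowIdeal (k : Type w) (V : Type u) [Field k] [Quiver.{v} V] [Fintype V] :
    Submodule k (PathAlgebra k V) :=
  ⊤ * Submodule.span k {r | ∃ (x y : V) (a : x ⟶ y), r = arrow k a} * ⊤

end PathAlgebra

open PathAlgebra

/-! ### Presentations -/

/-- The quiver has no oriented cycle, that is, no nontrivial path with equal source and target. -/
def Acyclic (V : Type u) [Quiver.{v} V] : Prop :=
  ∀ (x : V) (p : Quiver.Path x x), p.length = 0

/-- A subspace `I` of `kQ` (in practice a two-sided ideal) is admissible if
`(kQ⁺)^N ⊆ I ⊆ (kQ⁺)^2` for some `N ≥ 2`. -/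
def IsAdmissible {k : Type w} {V : Type u} [Field k] [Quiver.{v} V] [Fintype V]
    (I : Submodule k (PathAlgebra k V)) : Prop :=
  ∃ N : ℕ, 2 ≤ N ∧ arrowIdeal k V ^ N ≤ I ∧ I ≤ arrowIdeal k V ^ 2

/-- A complete set of primitive orthogonal idempotents. -/
structure IsCompletePrimitive {A : Type z} [Ring A] {V : Type u} [Fintype V] (e : V → A) :
    Prop where
  complete : CompleteOrthogonalIdempotents e
  ne_zero : ∀ x, e x ≠ 0
  primitive : ∀ x (a b : A), IsIdempotentElem a → IsIdempotentElem b → a * b = 0 → b * a = 0 →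
    e x = a + b → a = 0 ∨ b = 0

/-- The kernel of a homomorphism `ν : kQ → A`. -/
def kernel {k : Type w} {V : Type u} {A : Type z} [Field k] [Quiver.{v} V] [Fintype V] [Ring A]
    [Algebra k A] (ν : PathAlgebra k V →ₐ[k] A) : Submodule k (PathAlgebra k V) :=
  LinearMap.ker ν.toLinearMap

/-- `ν : kQ → A` is a presentation by quiver and admissible relations, normalised so that it sends
the trivial paths to the given idempotents `e`. (A finite dimensional algebra that has such a
presentation is basic with ordinary quiver `Q`, and it is connected if and only if `Q` is.) -/
structure IsPresentation {k : Type w} {V : Type u} {A : Type z} [Field k] [Quiver.{v} V]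
    [Fintype V] [Ring A] [Algebra k A] (e : V → A) (ν : PathAlgebra k V →ₐ[k] A) : Prop where
  surjective : Function.Surjective ν
  admissible : IsAdmissible (kernel ν)
  map_vertex : ∀ x, ν (vertex k x) = e x

/-! ### Minimal relations, walks, homotopy, and the fundamental group -/

/-- `r` is a minimal relation of `I`: a nonzero element of `I` such that, `r = ∑ tᵢ uᵢ` being its
expression through distinct paths `uᵢ` with nonzero coefficients, no nonempty proper partial sum
lies in `I`. -/
structure IsMinimalRelation {k : Type w} {V : Type u} [Field k] [Quiver.{v} V]
    (I : Submodule k (PathAlgebra k V)) (r : PathAlgebra k V) : Prop where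
  mem : r ∈ I
  ne_zero : r ≠ 0
  minimal : ∀ S : Finset (QPath V), S.Nonempty → S ⊂ ((basis k V).repr r).support →
    ∑ u ∈ S, (basis k V).repr r u • ofPath k u ∉ I

/-- A walk from `x` to `y`: a path in the double quiver, that is, a succession of arrows (`pos`)
and formal inverses of arrows (`neg`). -/
inductive Walk {V : Type u} [Quiver.{v} V] (x : V) : V → Type (max u v)
  | nil : Walk x x
  | pos {y z : V} (p : Walk x y) (a : y ⟶ z) : Walk x z
  | neg {y z : V} (p : Walk x y) (a : z ⟶ y) : Walk x z

namespace Walk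

variable {V : Type u} [Quiver.{v} V]

/-- The walk given by an arrow. -/
def ofArrow {x y : V} (a : x ⟶ y) : Walk x y := pos nil a

/-- The walk given by the formal inverse of an arrow. -/
def ofInv {x y : V} (a : x ⟶ y) : Walk y x := neg nil a

/-- The walk given by a path. -/
def ofPath {x : V} : ∀ {y : V}, Quiver.Path x y → Walk x y
  | _, Quiver.Path.nil => nil
  | _, Quiver.Path.cons p a => pos (ofPath p) a

/-- Concatenation: `p.comp q` is `p` followed by `q`. -/
def comp {x y : V} (p : Walk x y) : ∀ {z : V}, Walk y z → Walk x z
  | _, nil => p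
  | _, pos q a => pos (comp p q) a
  | _, neg q a => neg (comp p q) a

/-- The inverse walk. -/
def reverse {x : V} : ∀ {y : V}, Walk x y → Walk y x
  | _, nil => nil
  | _, pos p a => (ofInv a).comp (reverse p)
  | _, neg p a => (ofArrow a).comp (reverse p)

/-- The number of arrows and inverses of arrows in a walk. -/
def length {x : V} : ∀ {y : V}, Walk x y → ℕ
  | _, nil => 0
  | _, pos p _ => length p + 1
  | _, neg p _ => length p + 1

@[simp] theorem comp_nil {x y : V} (p : Walk x y) : p.comp nil = p := rfl

@[simp] theorem nil_comp {x y : V} (p : Walk x y) : nil.comp p = p := by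
  induction p with
  | nil => rfl
  | pos p a ih => rw [comp, ih]
  | neg p a ih => rw [comp, ih]

theorem comp_assoc {x y z w : V} (p : Walk x y) (q : Walk y z) (r : Walk z w) :
    (p.comp q).comp r = p.comp (q.comp r) := by
  induction r with
  | nil => rfl
  | pos r a ih => simp only [comp, ih]
  | neg r a ih => simp only [comp, ih]

theorem reverse_comp {x y z : V} (p : Walk x y) (q : Walk y z) :
    (p.comp q).reverse = q.reverse.comp p.reverse := by
  induction q with
  | nil => simp [reverse]
  | pos q a ih => simp only [comp, reverse, ih, comp_assoc]
  | neg q a ih => simp only [comp, reverse, ih, comp_assoc]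

theorem reverse_reverse {x y : V} (p : Walk x y) : p.reverse.reverse = p := by
  induction p with
  | nil => rfl
  | pos p a ih => rw [reverse, reverse_comp, ih]; rfl
  | neg p a ih => rw [reverse, reverse_comp, ih]; rfl

theorem ofPath_comp {x y z : V} (p : Quiver.Path x y) (q : Quiver.Path y z) :
    ofPath (p.comp q) = (ofPath p).comp (ofPath q) := by
  induction q with
  | nil => rfl
  | cons q a ih => rw [Quiver.Path.comp_cons, ofPath, ih]; rfl

end Walk

/-- The homotopy relation of `I` on walks: the equivalence relation, compatible with
concatenation, generated by `α α⁻¹ ~ e_y` and `α⁻¹ α ~ e_x` for the arrows `α : x → y`, and by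
`p ~ q` if `p` and `q` are paths that occur in a same minimal relation of `I`.
(`p.comp q` is `p` followed by `q`, that is, `q p` if one writes from the right to the left.) -/
inductive Homotopic {k : Type w} {V : Type u} [Field k] [Quiver.{v} V]
    (I : Submodule k (PathAlgebra k V)) : ∀ {x y : V}, Walk x y → Walk x y → Prop
  | refl {x y : V} (p : Walk x y) : Homotopic I p p
  | symm {x y : V} {p q : Walk x y} : Homotopic I p q → Homotopic I q p
  | trans {x y : V} {p q r : Walk x y} : Homotopic I p q → Homotopic I q r → Homotopic I p r
  | neg_pos {x y : V} (a : x ⟶ y) :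
      Homotopic I ((Walk.ofInv a).comp (Walk.ofArrow a)) Walk.nil
  | pos_neg {x y : V} (a : x ⟶ y) :
      Homotopic I ((Walk.ofArrow a).comp (Walk.ofInv a)) Walk.nil
  | congr {x x' y' y : V} (p : Walk x x') {q q' : Walk x' y'} (r : Walk y' y) :
      Homotopic I q q' → Homotopic I ((p.comp q).comp r) ((p.comp q').comp r)
  | relation {x y : V} (p q : Quiver.Path x y) (r : PathAlgebra k V) :
      IsMinimalRelation I r → (basis k V).repr r ⟨p⟩ ≠ 0 → (basis k V).repr r ⟨q⟩ ≠ 0 →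
      Homotopic I (Walk.ofPath p) (Walk.ofPath q)

section Homotopy

variable {k : Type w} {V : Type u} [Field k] [Quiver.{v} V] {I : Submodule k (PathAlgebra k V)}

theorem Homotopic.comp {x y z : V} {p p' : Walk x y} {q q' : Walk y z}
    (hp : Homotopic I p p') (hq : Homotopic I q q') : Homotopic I (p.comp q) (p'.comp q') := by
  have h1 := Homotopic.congr Walk.nil q hp
  have h2 := Homotopic.congr p' Walk.nil hq
  simp only [Walk.nil_comp, Walk.comp_nil] at h1 h2
  exact h1.trans h2

theorem Homotopic.comp_reverse {x y : V} (p : Walk x y) :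
    Homotopic I (p.comp p.reverse) Walk.nil := by
  induction p with
  | nil => exact .refl _
  | pos p a ih =>
    have h := Homotopic.congr p p.reverse (Homotopic.pos_neg (I := I) a)
    rw [Walk.comp_nil, ← Walk.comp_assoc p, Walk.comp_assoc] at h
    exact h.trans ih
  | neg p a ih =>
    have h := Homotopic.congr p p.reverse (Homotopic.neg_pos (I := I) a)
    rw [Walk.comp_nil, ← Walk.comp_assoc p, Walk.comp_assoc] at h
    exact h.trans ih

theorem Homotopic.reverse_comp {x y : V} (p : Walk x y) :
    Homotopic I (p.reverse.comp p) Walk.nil := by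
  have h := Homotopic.comp_reverse (I := I) p.reverse
  rwa [Walk.reverse_reverse] at h

theorem Homotopic.reverse {x y : V} {p q : Walk x y} (h : Homotopic I p q) :
    Homotopic I p.reverse q.reverse := by
  have h1 : Homotopic I p.reverse (p.reverse.comp (q.comp q.reverse)) := by
    have := (Homotopic.comp (Homotopic.refl p.reverse) (Homotopic.comp_reverse (I := I) q)).symm
    rwa [Walk.comp_nil] at this
  have h2 : Homotopic I (p.reverse.comp (q.comp q.reverse))
      ((p.reverse.comp p).comp q.reverse) := by
    rw [Walk.comp_assoc]
    exact (Homotopic.refl _).comp (h.symm.comp (Homotopic.refl _))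
  have h3 : Homotopic I ((p.reverse.comp p).comp q.reverse) q.reverse := by
    have := (Homotopic.reverse_comp (I := I) p).comp (Homotopic.refl q.reverse)
    rwa [Walk.nil_comp] at this
  exact (h1.trans h2).trans h3

end Homotopy

/-- Homotopy of closed walks at `x₀`, as a setoid. -/
def homotopySetoid {k : Type w} {V : Type u} [Field k] [Quiver.{v} V]
    (I : Submodule k (PathAlgebra k V)) (x₀ : V) : Setoid (Walk x₀ x₀) where
  r := Homotopic I
  iseqv := ⟨Homotopic.refl, Homotopic.symm, Homotopic.trans⟩

/-- The fundamental group `π₁(Q, I, x₀)`: homotopy classes of walks from `x₀` to `x₀`. -/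
def FundamentalGroup {k : Type w} {V : Type u} [Field k] [Quiver.{v} V]
    (I : Submodule k (PathAlgebra k V)) (x₀ : V) : Type (max u v) :=
  Quotient (homotopySetoid I x₀)

namespace FundamentalGroup

variable {k : Type w} {V : Type u} [Field k] [Quiver.{v} V]

/-- The homotopy class of a closed walk. -/
def mk (I : Submodule k (PathAlgebra k V)) {x₀ : V} (γ : Walk x₀ x₀) : FundamentalGroup I x₀ :=
  Quotient.mk (homotopySetoid I x₀) γ

variable {I : Submodule k (PathAlgebra k V)} {x₀ : V}

/-- The product is the concatenation of walks, read from the right to the left. -/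
instance : Group (FundamentalGroup I x₀) where
  mul := Quotient.map₂ (fun γ' γ => γ.comp γ') fun _ _ h' _ _ h => Homotopic.comp h h'
  one := mk I Walk.nil
  inv := Quotient.map (fun γ => γ.reverse) fun _ _ h => Homotopic.reverse h
  mul_assoc := by
    rintro ⟨a⟩ ⟨b⟩ ⟨c⟩
    exact congrArg (mk I) (Walk.comp_assoc c b a).symm
  one_mul := by
    rintro ⟨a⟩
    exact congrArg (mk I) (Walk.comp_nil a)
  mul_one := by
    rintro ⟨a⟩
    exact congrArg (mk I) (Walk.nil_comp a)
  inv_mul_cancel := by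
    rintro ⟨a⟩
    exact Quotient.sound (s := homotopySetoid I x₀) (Homotopic.comp_reverse a)

end FundamentalGroup

/-- The group `Hom(π₁(Q, I, x₀), k⁺)` of additive characters. -/
abbrev AdditiveCharacter {k : Type w} {V : Type u} [Field k] [Quiver.{v} V]
    (I : Submodule k (PathAlgebra k V)) (x₀ : V) : Type (max u v w) :=
  Additive (FundamentalGroup I x₀) →+ k

/-- The value `g([γ])` of an additive character at a closed walk. -/
def AdditiveCharacter.eval {k : Type w} {V : Type u} [Field k] [Quiver.{v} V]
    {I : Submodule k (PathAlgebra k V)} {x₀ : V} (g : AdditiveCharacter I x₀) (γ : Walk x₀ x₀) :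
    k :=
  g (Additive.ofMul (FundamentalGroup.mk I γ))

/-! ### Maximal trees -/

/-- `T`, a set of arrows, together with all the vertices, is a maximal tree of the quiver: the
underlying graph of `T` has no multiple edges and no loops, and it is a tree. -/
structure IsMaximalTree {V : Type u} [Quiver.{v} V] (T : WideSubquiver V) : Prop where
  simple : ∀ x y : V, Subsingleton ({a : x ⟶ y // a ∈ T x y} ⊕ {a : y ⟶ x // a ∈ T y x})
  isTree : (SimpleGraph.fromRel fun x y : V => ∃ a : x ⟶ y, a ∈ T x y).IsTree

/-- All arrows of the walk (up to inversion) belong to `T`. -/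
def WalkIn {V : Type u} [Quiver.{v} V] (T : WideSubquiver V) {x : V} : ∀ {y : V}, Walk x y → Prop
  | _, Walk.nil => True
  | _, Walk.pos p a => WalkIn T p ∧ a ∈ T _ _
  | _, Walk.neg p a => WalkIn T p ∧ a ∈ T _ _

theorem IsMaximalTree.exists_walk {V : Type u} [Quiver.{v} V] {T : WideSubquiver V}
    (hT : IsMaximalTree T) (x y : V) : ∃ γ : Walk x y, WalkIn T γ := by
  obtain ⟨p⟩ := hT.isTree.connected.preconnected y x
  induction p with
  | nil => exact ⟨Walk.nil, trivial⟩
  | cons h p ih =>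
    obtain ⟨γ, hγ⟩ := ih
    rw [SimpleGraph.fromRel_adj] at h
    rcases h.2 with ⟨a, ha⟩ | ⟨a, ha⟩
    · exact ⟨Walk.neg γ a, hγ, ha⟩
    · exact ⟨Walk.pos γ a, hγ, ha⟩

theorem IsMaximalTree.exists_minimal_walk {V : Type u} [Quiver.{v} V] {T : WideSubquiver V}
    (hT : IsMaximalTree T) (x y : V) :
    ∃ γ : Walk x y, WalkIn T γ ∧ ∀ γ' : Walk x y, WalkIn T γ' → γ.length ≤ γ'.length := by
  classical
  have h : ∃ n, ∃ γ : Walk x y, WalkIn T γ ∧ γ.length = n := by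
    obtain ⟨γ, hγ⟩ := hT.exists_walk x y
    exact ⟨_, γ, hγ, rfl⟩
  obtain ⟨γ, hγ, hn⟩ := Nat.find_spec h
  exact ⟨γ, hγ, fun γ' hγ' => hn ▸ Nat.find_min' h ⟨γ', hγ', rfl⟩⟩

/-- The walk `γ_x` of minimal length in the tree from `x₀` to `x`. -/
def treeWalk {V : Type u} [Quiver.{v} V] {T : WideSubquiver V} (hT : IsMaximalTree T) (x₀ x : V) :
    Walk x₀ x :=
  (hT.exists_minimal_walk x₀ x).choose

/-- The closed walk `γ_y⁻¹ u γ_x` at `x₀` of a path `u` from `x` to `y`. -/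
def closeUp {V : Type u} [Quiver.{v} V] {T : WideSubquiver V} (hT : IsMaximalTree T) (x₀ : V)
    (u : QPath V) : Walk x₀ x₀ :=
  ((treeWalk hT x₀ u.src).comp (Walk.ofPath u.path)).comp (treeWalk hT x₀ u.tgt).reverse

/-! ### Unitary derivations and the first Hochschild cohomology group -/

section Hochschild

variable (k : Type w) {A : Type z} {V : Type u} [Field k] [Ring A] [Algebra k A]

/-- The space `Der₀(A)` of unitary derivations: those that vanish at the given idempotents. -/
def Der₀ (e : V → A) : Submodule k (A →ₗ[k] A) where
  carrier := {d | (∀ a b, d (a * b) = a * d b + d a * b) ∧ ∀ x, d (e x) = 0}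
  zero_mem' := by simp
  add_mem' := by
    rintro d d' ⟨h, h0⟩ ⟨h', h0'⟩
    refine ⟨fun a b => ?_, fun x => by simp [h0, h0']⟩
    simp only [LinearMap.add_apply, h, h', mul_add, add_mul]
    abel
  smul_mem' := by
    rintro c d ⟨h, h0⟩
    refine ⟨fun a b => ?_, fun x => by simp [h0]⟩
    simp only [LinearMap.smul_apply, h, smul_add, mul_smul_comm, smul_mul_assoc]

/-- The inner derivation `δ_c : a ↦ c a - a c`, linear in `c`. -/
def innerDer : A →ₗ[k] A →ₗ[k] A := LinearMap.mul k A - (LinearMap.mul k A).flip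

/-- The space `Int₀(A) = {δ_c | c ∈ E}`, where `E` is the span of the given idempotents. -/
def Int₀ (e : V → A) : Submodule k (A →ₗ[k] A) :=
  (Submodule.span k (Set.range e)).map (innerDer k)

instance (e : V → A) : AddCommGroup (Der₀ k e) := Submodule.addCommGroup (Der₀ k e)

/-- The first Hochschild cohomology group, presented as `Der₀(A) / Int₀(A)`. -/
abbrev HH1 (e : V → A) : Type z := Der₀ k e ⧸ (Int₀ k e).submoduleOf (Der₀ k e)

/-- The class in the first Hochschild cohomology group of a unitary derivation. -/
abbrev HH1.mk (e : V → A) : Der₀ k e →ₗ[k] HH1 k e :=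
  ((Int₀ k e).submoduleOf (Der₀ k e)).mkQ

theorem Int₀_le_Der₀ [Fintype V] {e : V → A} (he : CompleteOrthogonalIdempotents e) :
    Int₀ k e ≤ Der₀ k e := by
  classical
  rintro _ ⟨c, hc, rfl⟩
  refine ⟨fun a b => ?_, fun x => ?_⟩
  · simp only [innerDer, LinearMap.sub_apply, LinearMap.mul_apply', LinearMap.flip_apply]
    noncomm_ring
  · induction hc using Submodule.span_induction with
    | mem c hc =>
      obtain ⟨y, rfl⟩ := hc
      simp [innerDer, he.mul_eq, eq_comm]
      grind
    | zero => simp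
    | add c c' _ _ h h' => simp [h, h']
    | smul t c _ h => simp [h]

end Hochschild

/-! ### Bases and diagonalizability -/

section Diagonal

variable {k : Type w} {A : Type z} {V : Type u} [Field k] [Ring A] [Algebra k A]

/-- A basis `B` of `A` in the sense used here: a basis of the vector space `A` whose elements lie
in the subspaces `e_j A e_i`, which contains the idempotents `e_i`, and whose other elements lie
in the radical of `A`. -/
structure IsAlgBasis (k : Type w) [Field k] [Algebra k A] (e : V → A) (B : Set A) : Prop where
  linearIndependent : LinearIndependent k ((↑) : B → A)
  span_eq_top : Submodule.span k B = ⊤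
  homogeneous : ∀ b ∈ B, ∃ (i j : V) (a : A), b = e j * a * e i
  idempotent_mem : ∀ i, e i ∈ B
  mem_radical : ∀ b ∈ B, b ∉ Set.range e → b ∈ Ring.jacobson A

/-- The linear map `d` is diagonal with respect to `B`. -/
def IsDiagonalMap (B : Set A) (d : A →ₗ[k] A) : Prop :=
  ∀ b ∈ B, ∃ t : k, d b = t • b

/-- A class in the first Hochschild cohomology group is diagonal with respect to `B` if it is
represented by a unitary derivation that is diagonal with respect to `B`. -/
def HH1.IsDiagonal {e : V → A} (B : Set A) (f : HH1 k e) : Prop :=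
  ∃ d : Der₀ k e, HH1.mk k e d = f ∧ IsDiagonalMap B (d : A →ₗ[k] A)

theorem isDiagonalMap_innerDer [Fintype V] {e : V → A} (he : CompleteOrthogonalIdempotents e)
    {B : Set A} (hB : IsAlgBasis k e B) {d : A →ₗ[k] A} (hd : d ∈ Int₀ k e) :
    IsDiagonalMap B d := by
  classical
  intro b hb
  obtain ⟨i, j, a, rfl⟩ := hB.homogeneous b hb
  obtain ⟨c, hc, rfl⟩ := hd
  induction hc using Submodule.span_induction with
  | mem c hc =>
    obtain ⟨y, rfl⟩ := hc
    refine ⟨(if y = j then 1 else 0) - (if i = y then 1 else 0), ?_⟩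
    have h1 : e y * (e j * a * e i) = (if y = j then (1 : k) else 0) • (e j * a * e i) := by
      rw [mul_assoc (e j), ← mul_assoc (e y), he.mul_eq]; split_ifs <;> simp_all
    have h2 : (e j * a * e i) * e y = (if i = y then (1 : k) else 0) • (e j * a * e i) := by
      rw [mul_assoc (e j * a), he.mul_eq]; split_ifs <;> simp_all
    simp only [innerDer, LinearMap.sub_apply, LinearMap.mul_apply', LinearMap.flip_apply, h1, h2,
      sub_smul]
  | zero => exact ⟨0, by simp⟩
  | add c c' _ _ h h' =>
    obtain ⟨t, ht⟩ := h
    obtain ⟨t', ht'⟩ := h'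
    exact ⟨t + t', by rw [map_add, LinearMap.add_apply, ht, ht', add_smul]⟩
  | smul s c _ h =>
    obtain ⟨t, ht⟩ := h
    exact ⟨s * t, by rw [map_smul, LinearMap.smul_apply, ht, mul_smul]⟩

/-- Being diagonal does not depend on the choice of the unitary derivation that represents the
class. -/
theorem HH1.isDiagonal_mk_iff [Fintype V] {e : V → A} (he : CompleteOrthogonalIdempotents e)
    {B : Set A} (hB : IsAlgBasis k e B) (d : Der₀ k e) :
    HH1.IsDiagonal B (HH1.mk k e d) ↔ IsDiagonalMap B (d : A →ₗ[k] A) := by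
  refine ⟨?_, fun h => ⟨d, rfl, h⟩⟩
  rintro ⟨d', h, hd'⟩ b hb
  have h' := (Submodule.Quotient.eq _).1 h
  obtain ⟨s, hs⟩ := isDiagonalMap_innerDer he hB (Submodule.mem_comap.1 h') b hb
  obtain ⟨t, ht⟩ := hd' b hb
  refine ⟨t - s, ?_⟩
  rw [sub_smul, ← ht, ← hs]
  simp

end Diagonal

/-! ### The homomorphism `θ_ν` -/

section Theta

variable {k : Type w} {V : Type u} {A : Type z} [Field k] [Quiver.{v} V] [Fintype V] [Ring A]
  [Algebra k A]

/-- The presentation `ν` is adapted to the basis `B`. -/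
def IsAdapted (ν : PathAlgebra k V →ₐ[k] A) (B : Set A) : Prop :=
  ∀ (x y : V) (a : x ⟶ y), ν (arrow k a) ∈ B

/-- The sum of the terms of `r` at the paths of `S`. -/
def restr (r : PathAlgebra k V) (S : Finset (QPath V)) : PathAlgebra k V :=
  ∑ u ∈ S, (basis k V).repr r u • ofPath k u

theorem restr_support (r : PathAlgebra k V) :
    restr r ((basis k V).repr r).support = r := by
  conv_rhs => rw [← (basis k V).linearCombination_repr r, Finsupp.linearCombination_apply]
  rfl

open Classical in
theorem repr_restr (r : PathAlgebra k V) (S : Finset (QPath V)) (u : QPath V) :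
    (basis k V).repr (restr r S) u = if u ∈ S then (basis k V).repr r u else 0 := by
  rw [restr, map_sum, Finsupp.finsetSum_apply]
  simp only [map_smul, ofPath, Module.Basis.repr_self, Finsupp.smul_apply, Finsupp.single_apply,
    smul_eq_mul, mul_ite, mul_one, mul_zero]
  exact Finset.sum_ite_eq' S u _

/-- Every element of `I` is a sum of minimal relations. -/
theorem mem_span_minimal (I : Submodule k (PathAlgebra k V)) (r : PathAlgebra k V) (hr : r ∈ I) :
    r ∈ Submodule.span k {s | IsMinimalRelation I s} := by
  classical
  induction hn : ((basis k V).repr r).support.card using Nat.strong_induction_on generalizing r with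
  | _ n ih =>
  by_cases h0 : r = 0
  · rw [h0]; exact zero_mem _
  by_cases hmin : IsMinimalRelation I r
  · exact Submodule.subset_span hmin
  have : ∃ S : Finset (QPath V), S.Nonempty ∧ S ⊂ ((basis k V).repr r).support ∧ restr r S ∈ I := by
    by_contra hcon
    push Not at hcon
    exact hmin ⟨hr, h0, fun S h1 h2 => hcon S h1 h2⟩
  obtain ⟨S, ⟨p, hp⟩, hS, hSI⟩ := this
  have hsub : ((basis k V).repr (restr r S)).support ⊆ S := by
    intro u hu
    by_contra h
    simp [repr_restr, h] at hu
  have hsub' : ((basis k V).repr (r - restr r S)).support ⊆ ((basis k V).repr r).support.erase p := by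
    intro u hu
    rw [Finsupp.mem_support_iff, map_sub, Finsupp.sub_apply, repr_restr] at hu
    rw [Finset.mem_erase, Finsupp.mem_support_iff]
    constructor
    · rintro rfl; simp [hp] at hu
    · intro h; simp [h] at hu
  have h1 := ih _ (hn ▸ (Finset.card_le_card hsub).trans_lt (Finset.card_lt_card hS)) _ hSI rfl
  have h2 := ih _ (hn ▸ (Finset.card_le_card hsub').trans_lt
    (Finset.card_erase_lt_of_mem (hS.1 hp))) _ (sub_mem hr hSI) rfl
  simpa using add_mem h2 h1

open Classical in
theorem vertex_mul_mul_vertex (x y : V) (r : PathAlgebra k V) :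
    vertex k y * r * vertex k x
      = restr r (((basis k V).repr r).support.filter fun u => u.src = x ∧ u.tgt = y) := by
  conv_lhs => rw [← restr_support r]
  rw [restr, restr, Finset.mul_sum, Finset.sum_mul, Finset.sum_filter]
  refine Finset.sum_congr rfl fun u _ => ?_
  rw [mul_smul_comm, smul_mul_assoc]
  split_ifs with h
  · obtain ⟨rfl, rfl⟩ := h
    rw [vertex_mul_ofPath, ofPath_mul_vertex]
  · by_cases hy : u.tgt = y
    · subst hy
      rw [vertex_mul_ofPath, ofPath_mul_vertex_ne u (fun hx => h ⟨hx, rfl⟩), smul_zero]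
    · rw [vertex_mul_ofPath_ne u hy, zero_mul, smul_zero]

/-- The paths that occur in a minimal relation are parallel. -/
theorem IsMinimalRelation.parallel {ν : PathAlgebra k V →ₐ[k] A} {r : PathAlgebra k V}
    (hr : IsMinimalRelation (kernel ν) r) {p q : QPath V} (hp : (basis k V).repr r p ≠ 0)
    (hq : (basis k V).repr r q ≠ 0) : q.src = p.src ∧ q.tgt = p.tgt := by
  classical
  set S := ((basis k V).repr r).support.filter fun u => u.src = p.src ∧ u.tgt = p.tgt with hS
  by_contra hcon
  refine hr.minimal S ⟨p, by simp [hS, hp]⟩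
    (Finset.ssubset_iff_subset_ne.2 ⟨Finset.filter_subset _ _, fun h => ?_⟩) ?_
  · have : q ∈ S := by rw [h]; simpa using hq
    exact hcon (Finset.mem_filter.1 this).2
  · have h1 : ν r = 0 := hr.mem
    have h2 := vertex_mul_mul_vertex p.src p.tgt r
    change restr r S ∈ kernel ν
    rw [← h2]
    change ν _ = 0
    rw [map_mul, map_mul, h1, mul_zero, zero_mul]

/-- The linear map on `kQ` that multiplies every path `u` by `g([γ_y⁻¹ u γ_x])`. -/
def diagMap {T : WideSubquiver V} (hT : IsMaximalTree T) (x₀ : V)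
    {I : Submodule k (PathAlgebra k V)} (g : AdditiveCharacter I x₀) :
    PathAlgebra k V →ₗ[k] PathAlgebra k V :=
  (basis k V).constr k fun u => g.eval (closeUp hT x₀ u) • ofPath k u

theorem diagMap_ofPath {T : WideSubquiver V} (hT : IsMaximalTree T) (x₀ : V)
    {I : Submodule k (PathAlgebra k V)} (g : AdditiveCharacter I x₀) (u : QPath V) :
    diagMap hT x₀ g (ofPath k u) = g.eval (closeUp hT x₀ u) • ofPath k u := by
  rw [diagMap, ofPath, Module.Basis.constr_basis]; rfl

theorem AdditiveCharacter.eval_comp {x₀ : V} {I : Submodule k (PathAlgebra k V)}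
    (g : AdditiveCharacter I x₀) (γ γ' : Walk x₀ x₀) :
    g.eval (γ.comp γ') = g.eval γ' + g.eval γ := by
  unfold AdditiveCharacter.eval
  rw [← map_add]; rfl

theorem AdditiveCharacter.eval_congr {x₀ : V} {I : Submodule k (PathAlgebra k V)}
    (g : AdditiveCharacter I x₀) {γ γ' : Walk x₀ x₀} (h : Homotopic I γ γ') :
    g.eval γ = g.eval γ' := by
  unfold AdditiveCharacter.eval
  congr 2
  exact Quotient.sound (s := homotopySetoid I x₀) h

theorem eval_closeUp_comp {T : WideSubquiver V} (hT : IsMaximalTree T) (x₀ : V)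
    {I : Submodule k (PathAlgebra k V)} (g : AdditiveCharacter I x₀) {x y z : V}
    (p : Quiver.Path x y) (q : Quiver.Path y z) :
    g.eval (closeUp hT x₀ ⟨p.comp q⟩)
      = g.eval (closeUp hT x₀ ⟨q⟩) + g.eval (closeUp hT x₀ ⟨p⟩) := by
  rw [← AdditiveCharacter.eval_comp]
  refine (g.eval_congr ?_).symm
  have h := Homotopic.congr (I := I) ((treeWalk hT x₀ x).comp (Walk.ofPath p))
    ((Walk.ofPath q).comp (treeWalk hT x₀ z).reverse) (Homotopic.reverse_comp (treeWalk hT x₀ y))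
  simpa [closeUp, Walk.comp_assoc, Walk.ofPath_comp] using h

theorem eval_closeUp_nil {T : WideSubquiver V} (hT : IsMaximalTree T) (x₀ : V)
    {I : Submodule k (PathAlgebra k V)} (g : AdditiveCharacter I x₀) (x : V) :
    g.eval (closeUp hT x₀ ⟨(Quiver.Path.nil : Quiver.Path x x)⟩) = 0 := by
  have h := eval_closeUp_comp hT x₀ g (Quiver.Path.nil : Quiver.Path x x) Quiver.Path.nil
  rw [Quiver.Path.comp_nil] at h
  simpa using h

theorem diagMap_mul {T : WideSubquiver V} (hT : IsMaximalTree T) (x₀ : V)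
    {I : Submodule k (PathAlgebra k V)} (g : AdditiveCharacter I x₀) (a b : PathAlgebra k V) :
    diagMap hT x₀ g (a * b) = a * diagMap hT x₀ g b + diagMap hT x₀ g a * b := by
  induction a using induction_path with
  | h0 => simp
  | ha a a' h h' => rw [add_mul, map_add, h, h', map_add, add_mul, add_mul]; abel
  | hs t a h => rw [smul_mul_assoc, map_smul, h, map_smul, smul_mul_assoc, smul_mul_assoc, smul_add]
  | hp q =>
  induction b using induction_path with
  | h0 => simp
  | ha a a' h h' => rw [mul_add, map_add, h, h', map_add, mul_add, mul_add]; abel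
  | hs t a h => rw [mul_smul_comm, map_smul, h, map_smul, mul_smul_comm, mul_smul_comm, smul_add]
  | hp p =>
  rw [diagMap_ofPath, diagMap_ofPath, mul_smul_comm, smul_mul_assoc, ← add_smul, ofPath_mul]
  obtain @⟨x, y, p⟩ := p
  obtain @⟨y', z, q⟩ := q
  by_cases h : y = y'
  · subst h
    rw [mulPath_comp, diagMap_ofPath, eval_closeUp_comp, add_comm]
  · rw [mulPath_ne h, map_zero, smul_zero]

theorem diagMap_mem_kernel {T : WideSubquiver V} (hT : IsMaximalTree T) (x₀ : V)
    (ν : PathAlgebra k V →ₐ[k] A) (g : AdditiveCharacter (kernel ν) x₀) :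
    kernel ν ≤ (kernel ν).comap (diagMap hT x₀ g) := by
  intro r hr
  have hle : Submodule.span k {s | IsMinimalRelation (kernel ν) s}
      ≤ (kernel ν).comap (diagMap hT x₀ g) := by
    rw [Submodule.span_le]
    intro s hs
    obtain ⟨p, hp⟩ : ∃ p, (basis k V).repr s p ≠ 0 := by
      by_contra hcon
      push Not at hcon
      exact hs.ne_zero ((basis k V).repr.map_eq_zero_iff.1 (Finsupp.ext hcon))
    have key : diagMap hT x₀ g s = g.eval (closeUp hT x₀ p) • s := by
      conv_lhs => rw [← restr_support s]
      conv_rhs => rw [← restr_support s]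
      rw [restr, map_sum, Finset.smul_sum]
      refine Finset.sum_congr rfl fun q hq => ?_
      have hq' := Finsupp.mem_support_iff.1 hq
      rw [map_smul, diagMap_ofPath, smul_comm]
      congr 1
      obtain ⟨h1, h2⟩ := hs.parallel hp hq'
      obtain @⟨x, y, p⟩ := p
      obtain @⟨x', y', q⟩ := q
      dsimp only at h1 h2
      subst h1 h2
      refine g.eval_congr ?_
      exact Homotopic.congr _ _ (Homotopic.relation q p s hs hq' hp)
    change diagMap hT x₀ g s ∈ kernel ν
    rw [key]
    exact Submodule.smul_mem _ _ hs.mem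
  exact hle (mem_span_minimal _ r hr)

variable {e : V → A} {ν : PathAlgebra k V →ₐ[k] A}

/-- An additive character `g` defines a unique unitary derivation `g̃` of `A` such that
`g̃(ν(u)) = g([γ_y⁻¹ u γ_x]) ν(u)` for every path `u` from `x` to `y`. -/
theorem existsUnique_derivation (hν : IsPresentation e ν) {T : WideSubquiver V}
    (hT : IsMaximalTree T) (x₀ : V) (g : AdditiveCharacter (kernel ν) x₀) :
    ∃! d : Der₀ k e, ∀ u : QPath V,
      (d : A →ₗ[k] A) (ν (ofPath k u)) = g.eval (closeUp hT x₀ u) • ν (ofPath k u) := by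
  have hs : Function.Surjective ν.toLinearMap := hν.surjective
  let d : A →ₗ[k] PathAlgebra k V ⧸ kernel ν := ((kernel ν).mapQ (kernel ν) (diagMap hT x₀ g)
      (diagMap_mem_kernel hT x₀ ν g)).comp
      (ν.toLinearMap.quotKerEquivOfSurjective hs).symm.toLinearMap
  let d' : A →ₗ[k] A := (ν.toLinearMap.quotKerEquivOfSurjective hs).toLinearMap.comp d
  have hd : ∀ a, d' (ν a) = ν (diagMap hT x₀ g a) := by
    intro a
    have h1 : (ν.toLinearMap.quotKerEquivOfSurjective hs).symm (ν a)
        = Submodule.Quotient.mk a := by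
      rw [LinearEquiv.symm_apply_eq]; rfl
    change ν.toLinearMap.quotKerEquivOfSurjective hs ((kernel ν).mapQ (kernel ν) (diagMap hT x₀ g)
      (diagMap_mem_kernel hT x₀ ν g) ((ν.toLinearMap.quotKerEquivOfSurjective hs).symm (ν a))) = _
    rw [h1]; rfl
  have hder : d' ∈ Der₀ k e := by
    refine ⟨fun a b => ?_, fun x => ?_⟩
    · obtain ⟨a, rfl⟩ := hν.surjective a
      obtain ⟨b, rfl⟩ := hν.surjective b
      rw [← map_mul, hd, diagMap_mul, map_add, map_mul, map_mul, hd, hd]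
    · rw [← hν.map_vertex, hd, vertex, diagMap_ofPath, eval_closeUp_nil, zero_smul, map_zero]
  refine ⟨⟨d', hder⟩, fun u => ?_, fun d'' h'' => Subtype.ext (LinearMap.ext fun a => ?_)⟩
  · change d' _ = _
    rw [hd, diagMap_ofPath, map_smul]
  · obtain ⟨a, rfl⟩ := hν.surjective a
    change _ = d' (ν a)
    induction a using induction_path with
    | h0 => simp
    | ha a a' h h' => simp only [map_add, h, h']
    | hs t a h => simp only [map_smul, h]
    | hp p => rw [h'', hd, diagMap_ofPath, map_smul]

/-- The unitary derivation `g̃` of `A` given by an additive character `g`. -/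
def charDerivation (hν : IsPresentation e ν) {T : WideSubquiver V} (hT : IsMaximalTree T) (x₀ : V)
    (g : AdditiveCharacter (kernel ν) x₀) : Der₀ k e :=
  (existsUnique_derivation hν hT x₀ g).choose

theorem charDerivation_apply (hν : IsPresentation e ν) {T : WideSubquiver V}
    (hT : IsMaximalTree T) (x₀ : V) (g : AdditiveCharacter (kernel ν) x₀) (u : QPath V) :
    (charDerivation hν hT x₀ g : A →ₗ[k] A) (ν (ofPath k u))
      = g.eval (closeUp hT x₀ u) • ν (ofPath k u) :=
  (existsUnique_derivation hν hT x₀ g).choose_spec.1 u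

/-- The homomorphism `θ_ν : Hom(π₁(Q, Ker ν), k⁺) → HH¹(A)`, which sends `g` to the class
of `g̃`. -/
def theta (hν : IsPresentation e ν) {T : WideSubquiver V} (hT : IsMaximalTree T) (x₀ : V) :
    AdditiveCharacter (kernel ν) x₀ →+ HH1 k e :=
  AddMonoidHom.mk' (fun g => HH1.mk k e (charDerivation hν hT x₀ g)) fun g g' => by
    rw [← map_add]
    congr 1
    refine (existsUnique_derivation hν hT x₀ (g + g')).unique
      (charDerivation_apply hν hT x₀ (g + g')) fun u => ?_
    rw [Submodule.coe_add, LinearMap.add_apply, charDerivation_apply, charDerivation_apply,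
      ← add_smul]
    rfl

end Theta

/-- The sum `t_γ = ∑ ε_i t_{α_i}` of a walk `γ = α_n^{ε_n} … α_1^{ε_1}` for a given family of
scalars `t_α`. -/
def walkWeight {k : Type w} {V : Type u} [Field k] [Quiver.{v} V] (t : ∀ x y : V, (x ⟶ y) → k)
    {x : V} : ∀ {y : V}, Walk x y → k
  | _, Walk.nil => 0
  | _, Walk.pos p a => walkWeight t p + t _ _ a
  | _, Walk.neg p a => walkWeight t p - t _ _ a

end QuiverHH

end

/-! The scalars `t_α` extend additively to a weight on all walks, an arrow counting `t_α` and its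
formal inverse `-t_α`. By the Leibniz rule, a unitary derivation `d` with `d(ν(α)) = t_α ν(α)` on
arrows scales `ν(u)` by the weight of `u`, for every path `u` (`derivation_ofPath`).

The weight descends to `π₁` because paths in a same minimal relation have equal weight, and this is
linear algebra (`IsMinimalRelation.eigenvalue_eq`). Group the terms of a minimal relation by weight.
The images of the groups lie in distinct eigenspaces of `d` and sum to zero, so each of them
vanishes; each group is then itself an element of the kernel, and minimality leaves room for one
group only. The other generators of homotopy preserve the weight by cancellation
(`walkWeight_eq_of_homotopic`), so an additive character `g` results (`weightCharacter`).

It remains to compare `g̃` with `d` (`theta_eq_of_eval`). On a path `u` from `x` to `y`, `g̃` has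
eigenvalue `w(γ_x) + w(u) - w(γ_y)` and `d` has eigenvalue `w(u)`. The difference depends only on
the endpoints and is a coboundary: it is the eigenvalue of the inner derivation given by `c = -∑
w(γ_x) e_x` (`innerDer_ofPath`). Hence `g̃` and `d` have the same class. -/

namespace QuiverHH

open PathAlgebra

/-! ### Weights of walks and the additive characters they define -/

section WalkWeight

variable {k : Type w} {V : Type u} [Field k] [Quiver.{v} V] (t : ∀ x y : V, (x ⟶ y) → k)

/-- Makes the weight a functor from walks to the additive group of `k`. Compatibility with
congruence of walks and the homomorphism property of the character both come down to this. -/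
theorem walkWeight_comp {x y z : V} (p : Walk x y) (q : Walk y z) :
    walkWeight t (p.comp q) = walkWeight t p + walkWeight t q := by
  induction q with
  | nil => simp [walkWeight]
  | pos q a ih => rw [Walk.comp, walkWeight, ih, walkWeight, add_assoc]
  | neg q a ih => rw [Walk.comp, walkWeight, ih, walkWeight, add_sub_assoc]

/-- Serves the return leg `γ_y⁻¹` of a path closed up at `x₀`. -/
theorem walkWeight_reverse {x y : V} (p : Walk x y) :
    walkWeight t p.reverse = -walkWeight t p := by
  induction p with
  | nil => simp [Walk.reverse, walkWeight]
  | pos p a ih =>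
    rw [Walk.reverse, walkWeight_comp, ih, Walk.ofInv]
    simp only [walkWeight]
    ring
  | neg p a ih =>
    rw [Walk.reverse, walkWeight_comp, ih, Walk.ofArrow]
    simp only [walkWeight]
    ring

/-- The weight is invariant under homotopy as soon as the paths occurring in a same minimal
relation have the same weight. -/
theorem walkWeight_eq_of_homotopic {I : Submodule k (PathAlgebra k V)}
    (ht : ∀ r, IsMinimalRelation I r → ∀ p q : QPath V, (basis k V).repr r p ≠ 0 →
      (basis k V).repr r q ≠ 0 →
        walkWeight t (Walk.ofPath p.path) = walkWeight t (Walk.ofPath q.path))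
    {x y : V} {p q : Walk x y} (h : Homotopic I p q) : walkWeight t p = walkWeight t q := by
  induction h with
  | refl => rfl
  | symm _ ih => exact ih.symm
  | trans _ _ ih ih' => exact ih.trans ih'
  | neg_pos a => simp [Walk.ofInv, Walk.ofArrow, Walk.comp, walkWeight]
  | pos_neg a => simp [Walk.ofInv, Walk.ofArrow, Walk.comp, walkWeight]
  | congr p r _ ih => simp only [walkWeight_comp, ih]
  -- The only generator that sees `I`; all the others preserve any weight whatsoever.
  | relation p q r hr hp hq => exact ht r hr ⟨p⟩ ⟨q⟩ hp hq

/-- The additive character given by a homotopy invariant weight. -/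
def weightCharacter {I : Submodule k (PathAlgebra k V)} (x₀ : V)
    (ht : ∀ γ γ' : Walk x₀ x₀, Homotopic I γ γ' → walkWeight t γ = walkWeight t γ') :
    AdditiveCharacter I x₀ :=
  AddMonoidHom.mk'
    (fun γ => Quotient.lift (s := homotopySetoid I x₀) (walkWeight t) ht (Additive.toMul γ)) <| by
    rintro ⟨γ⟩ ⟨γ'⟩
    -- The product in `π₁` is read from the right to the left, so the class of `γ` times that of
    -- `γ'` is represented by `γ'.comp γ`; commutativity of `k⁺` restores the order.
    exact (walkWeight_comp t γ' γ).trans (add_comm _ _)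

theorem weightCharacter_eval {I : Submodule k (PathAlgebra k V)} (x₀ : V)
    (ht : ∀ γ γ' : Walk x₀ x₀, Homotopic I γ γ' → walkWeight t γ = walkWeight t γ')
    (γ : Walk x₀ x₀) : (weightCharacter t x₀ ht).eval γ = walkWeight t γ :=
  rfl

end WalkWeight

/-! ### Eigenvalues of derivations on the images of paths -/

section Derivation

variable {k : Type w} {V : Type u} {A : Type z} [Field k] [Quiver.{v} V] [Fintype V] [Ring A]
  [Algebra k A] {e : V → A} {ν : PathAlgebra k V →ₐ[k] A} {t : ∀ x y : V, (x ⟶ y) → k}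

/-- A unitary derivation that has the images of the arrows as eigenvectors has the images of the
paths as eigenvectors. -/
theorem derivation_ofPath (hν : IsPresentation e ν) {d : A →ₗ[k] A} (hd : d ∈ Der₀ k e)
    (hdt : ∀ (x y : V) (a : x ⟶ y), d (ν (arrow k a)) = t x y a • ν (arrow k a)) (u : QPath V) :
    d (ν (ofPath k u)) = walkWeight t (Walk.ofPath u.path) • ν (ofPath k u) := by
  obtain @⟨x, y, u⟩ := u
  induction u with
  | nil =>
    change d (ν (vertex k x)) = (0 : k) • _
    rw [hν.map_vertex, hd.2, zero_smul]
  | cons u a ih =>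
    -- The last arrow of a path is its leftmost factor.
    have h : ofPath k ⟨u.cons a⟩ = arrow k a * ofPath k ⟨u⟩ := by
      rw [arrow, ofPath_mul, mulPath_comp]; rfl
    -- In the Leibniz rule `a * d b` comes first, so the eigenvalues add up in the order used by
    -- `walkWeight` and `rfl` finishes.
    rw [h, map_mul, hd.1, ih, hdt, mul_smul_comm, smul_mul_assoc, ← add_smul]
    rfl

/-- If a linear endomorphism of `A` has the images of the paths as eigenvectors, then the paths
that occur in a same minimal relation have the same eigenvalue. -/
theorem IsMinimalRelation.eigenvalue_eq {d : A →ₗ[k] A} {c : QPath V → k}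
    (hd : ∀ u, d (ν (ofPath k u)) = c u • ν (ofPath k u)) {r : PathAlgebra k V}
    (hr : IsMinimalRelation (kernel ν) r) {p q : QPath V} (hp : (basis k V).repr r p ≠ 0)
    (hq : (basis k V).repr r q ≠ 0) : c p = c q := by
  classical
  by_contra hcon
  -- `S` collects the terms with the eigenvalue of `p`, and `S'` all the others, whatever their
  -- eigenvalues.
  set S := ((basis k V).repr r).support.filter fun u => c u = c p with hS
  set S' := ((basis k V).repr r).support.filter fun u => ¬ c u = c p with hS'
  -- Membership in the eigenspace allows `ν(u) = 0`, so paths that `ν` kills need no separate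
  -- treatment.
  have hmem (u : QPath V) : (basis k V).repr r u • ν (ofPath k u) ∈
      Module.End.eigenspace d (c u) :=
    Submodule.smul_mem _ _ (Module.End.mem_eigenspace_iff.2 (hd u))
  have h1 : ν (restr r S) ∈ Module.End.eigenspace d (c p) := by
    rw [restr, map_sum]
    refine Submodule.sum_mem _ fun u hu => ?_
    rw [map_smul, ← (Finset.mem_filter.1 hu).2]
    exact hmem u
  have h2 : ν (restr r S') ∈ ⨆ (μ : k) (_ : μ ≠ c p), Module.End.eigenspace d μ := by
    rw [restr, map_sum]
    refine Submodule.sum_mem _ fun u hu => ?_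
    rw [map_smul]
    exact Submodule.mem_iSup_of_mem (c u)
      (Submodule.mem_iSup_of_mem (Finset.mem_filter.1 hu).2 (hmem u))
  have h3 : ν (restr r S) + ν (restr r S') = 0 := by
    rw [← map_add, restr, restr, hS, hS', Finset.sum_filter_add_sum_filter_not]
    exact (congrArg ν (restr_support r)).trans hr.mem
  have h4 : ν (restr r S) = 0 := by
    -- By `h3` the image of the `S`-part is minus that of the `S'`-part, so it lies both in one
    -- eigenspace and in the sum of the others; independence of eigenspaces makes it zero.
    refine (Submodule.disjoint_def.1 (Module.End.eigenspaces_iSupIndep d (c p))) _ h1 ?_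
    rw [eq_neg_of_add_eq_zero_left h3]
    exact neg_mem h2
  -- `S` contains `p` but, under the assumption `c p ≠ c q`, not `q`: it is a nonempty proper
  -- partial sum in the kernel.
  refine hr.minimal S ⟨p, by simp [hS, hp]⟩
    (Finset.ssubset_iff_subset_ne.2 ⟨Finset.filter_subset _ _, fun h => ?_⟩) h4
  have : q ∈ S := by rw [h]; simpa using hq
  exact hcon (Finset.mem_filter.1 this).2.symm

/-- The inner derivation of an element of `E` has the images of the paths as eigenvectors. -/
theorem innerDer_ofPath (hν : IsPresentation e ν) (c : V → k) (u : QPath V) :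
    innerDer k (∑ x, c x • e x) (ν (ofPath k u)) = (c u.tgt - c u.src) • ν (ofPath k u) := by
  have h1 : (∑ x, c x • vertex k x) * ofPath k u = c u.tgt • ofPath k u := by
    rw [Finset.sum_mul, Finset.sum_eq_single u.tgt, smul_mul_assoc, vertex_mul_ofPath]
    · intro x _ hx
      rw [smul_mul_assoc, vertex_mul_ofPath_ne u hx.symm, smul_zero]
    · simp
  have h2 : ofPath k u * (∑ x, c x • vertex k x) = c u.src • ofPath k u := by
    rw [Finset.mul_sum, Finset.sum_eq_single u.src, mul_smul_comm, ofPath_mul_vertex]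
    · intro x _ hx
      rw [mul_smul_comm, ofPath_mul_vertex_ne u hx.symm, smul_zero]
    · simp
  -- Lifting the element of `E` to `kQ` reduces the commutator to products of paths, where left
  -- multiplication reads off the target and right multiplication the source.
  have h3 : ∑ x, c x • e x = ν (∑ x, c x • vertex k x) := by
    simp only [map_sum, map_smul, hν.map_vertex]
  simp only [innerDer, LinearMap.sub_apply, LinearMap.mul_apply', LinearMap.flip_apply]
  rw [h3, ← map_mul, ← map_mul, h1, h2, map_smul, map_smul, sub_smul]

/-- If the values of an additive character `g` are the weights of a unitary derivation `d` that has
the images of the arrows as eigenvectors, then `θ_ν(g)` is the class of `d`. -/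
theorem theta_eq_of_eval (hν : IsPresentation e ν) {T : WideSubquiver V} (hT : IsMaximalTree T)
    (x₀ : V) (d : Der₀ k e)
    (hdt : ∀ (x y : V) (a : x ⟶ y),
      (d : A →ₗ[k] A) (ν (arrow k a)) = t x y a • ν (arrow k a))
    (g : AdditiveCharacter (kernel ν) x₀) (hg : ∀ γ : Walk x₀ x₀, g.eval γ = walkWeight t γ) :
    theta hν hT x₀ g = HH1.mk k e d := by
  refine (Submodule.Quotient.eq _).2 (Submodule.mem_comap.2 ?_)
  -- The sign is forced: `δ_c` has eigenvalue `c_y - c_x` on a path from `x` to `y`, and `g̃ - d`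
  -- has eigenvalue `w(γ_x) - w(γ_y)`.
  refine ⟨∑ x, (-walkWeight t (treeWalk hT x₀ x)) • e x,
    Submodule.sum_mem _ fun x _ => Submodule.smul_mem _ _ (Submodule.subset_span ⟨x, rfl⟩),
    LinearMap.ext fun a => ?_⟩
  -- Both sides are linear and the images of paths span `A`, so it is enough to compare eigenvalues
  -- on paths.
  obtain ⟨a, rfl⟩ := hν.surjective a
  induction a using induction_path with
  | h0 => simp
  | ha a a' h h' => simp only [map_add, h, h']
  | hs s a h => simp only [map_smul, h]
  | hp u =>
    rw [innerDer_ofPath hν]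
    change _ = (charDerivation hν hT x₀ g : A →ₗ[k] A) (ν (ofPath k u)) -
      (d : A →ₗ[k] A) (ν (ofPath k u))
    rw [charDerivation_apply, derivation_ofPath hν d.2 hdt, hg, ← sub_smul, closeUp,
      walkWeight_comp, walkWeight_comp, walkWeight_reverse]
    congr 1
    ring

end Derivation

end QuiverHH

/-! ### The lemma -/

open QuiverHH in
theorem lemma2p5 {k : Type w} [Field k] [IsAlgClosed k]
    {V : Type u} [Quiver.{v} V] [Fintype V] [∀ x y : V, Finite (x ⟶ y)] (hV : Acyclic V)
    {A : Type z} [Ring A] [Algebra k A] [FiniteDimensional k A]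
    {e : V → A} (he : IsCompletePrimitive e)
    {T : WideSubquiver V} (hT : IsMaximalTree T) (x₀ : V)
    {B : Set A} (hB : IsAlgBasis k e B)
    {f : HH1 k e} (hf : HH1.IsDiagonal B f)
    {ν : PathAlgebra k V →ₐ[k] A} (hν : IsPresentation e ν) (hνB : IsAdapted ν B) :
    f ∈ (theta hν hT x₀).range ∧
      ∀ d : Der₀ k e, HH1.mk k e d = f →
        ∀ t : ∀ x y : V, (x ⟶ y) → k,
          (∀ (x y : V) (a : x ⟶ y),
            (d : A →ₗ[k] A) (ν (PathAlgebra.arrow k a)) = t x y a • ν (PathAlgebra.arrow k a)) →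
          ∃ g : AdditiveCharacter (kernel ν) x₀,
            (∀ γ : Walk x₀ x₀, g.eval γ = walkWeight t γ) ∧ theta hν hT x₀ g = f := by
  have main : ∀ d : Der₀ k e, HH1.mk k e d = f → ∀ t : ∀ x y : V, (x ⟶ y) → k,
      (∀ (x y : V) (a : x ⟶ y),
        (d : A →ₗ[k] A) (ν (PathAlgebra.arrow k a)) = t x y a • ν (PathAlgebra.arrow k a)) →
      ∃ g : AdditiveCharacter (kernel ν) x₀,
        (∀ γ : Walk x₀ x₀, g.eval γ = walkWeight t γ) ∧ theta hν hT x₀ g = f := by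
    intro d hd t hdt
    refine ⟨weightCharacter t x₀ fun γ γ' h => walkWeight_eq_of_homotopic t
        (fun r hr p q hp hq => hr.eigenvalue_eq (derivation_ofPath hν d.2 hdt) hp hq) h,
      fun γ => weightCharacter_eval t x₀ _ γ, ?_⟩
    rw [← hd]
    exact theta_eq_of_eval hν hT x₀ d hdt _ fun γ => weightCharacter_eval t x₀ _ γ
  refine ⟨?_, main⟩
  obtain ⟨d, hd, hdB⟩ := hf
  -- Adaptedness puts the images of the arrows in `B`, and diagonality of `d` on `B` then supplies
  -- the scalars `t_α`.
  choose t ht using fun (x y : V) (a : x ⟶ y) => hdB _ (hνB x y a)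
  obtain ⟨g, -, hg⟩ := main d hd t ht
  exact ⟨g, hg⟩
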